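/- Let $a,b,c\in\mathbb R$ with $c>0$ and $a+b>0$. For $x_0>0$, let $S(x_0)$ be the set of all functions $u\in C^0([0,x_0])\cap C^2((0,x_0))$ that satisfy $$x^2u''(x)=a\,x\,u'(x)+b\,u(x)-c\,(u'(x)-1)^2\quad\text{for } 0<x<x_0,\qquad u(0)=0,$$ and $0\le u(x)\le x$ for all $x\in[0,x_0]$. Then for every $x_0>0$ the set $S(x_0)$ has the cardinality of the continuum, and every $u\in S(x_0)$ satisfies, as $x\searrow 0$, $$u(x)=x-\frac23\sqrt{\frac{a+b}{c}}\,x^{3/2}+o(x^{3/2}),\qquad u'(x)=1-\sqrt{\frac{a+b}{c}}\,x^{1/2}+o(x^{1/2}).$$ -/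

import Mathlib

open Set Filter Topology Asymptotics

/-- A solution on `[0, x₀]` of the singular initial value problem
`x² u'' = a x u' + b u - c (u' - 1)²`, `u(0) = 0`: a function of class `C⁰([0, x₀]) ∩ C²((0, x₀))`
which satisfies the equation on `(0, x₀)`. Only the values of `u` on `[0, x₀]` matter. -/
structure IsLocalSolution (a b c x₀ : ℝ) (u : ℝ → ℝ) : Prop where
  continuousOn : ContinuousOn u (Icc 0 x₀)
  contDiffOn : ContDiffOn ℝ 2 u (Ioo 0 x₀)
  equation : ∀ x ∈ Ioo 0 x₀,
    x ^ 2 * deriv (deriv u) x = a * x * deriv u x + b * u x - c * (deriv u x - 1) ^ 2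
  initial : u 0 = 0

/-- The solutions on `[0, x₀]` which satisfy `0 ≤ u(x) ≤ x` on `[0, x₀]`. -/
def boundedLocalSolutions (a b c x₀ : ℝ) : Set (ℝ → ℝ) :=
  {u | IsLocalSolution a b c x₀ u ∧ ∀ x ∈ Icc 0 x₀, 0 ≤ u x ∧ u x ≤ x}

open scoped NNReal

/-! With `v = x - u` and `w = v' = 1 - u'` the equation reads `x² w' = c w² + a x w + b v - (a + b)
x`, on the region `0 ≤ v ≤ x`.

Asymptotics: balancing `c w²` against `(a + b) x` suggests `w ~ κ √x` with `κ = √((a + b) / c)`. The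
quotient `y = w / √x` has `y' = e / (x √x)`, where `e` is `c y² - (a + b)` plus terms that turn out
to vanish at `0`. Where `|e|` is bounded below, `|y'| ≥ δ / x`, which is not integrable at `0`, so
`y` must leave (`eventually_lt_or_forall_le_of_deriv_ge`). This bounds `y` above, whence `v =
O(x^{3/2})` and `v / x → 0`; it then excludes all limits but `κ`, as `-κ` would force `v < 0`
(`tendsto_slope_div_sqrt`). Integration gives the expansion of `v`.

Cardinality: for each slope `p ∈ (0, 1)` prescribed at `T`, shoot backwards from `v(T) = ζ`. The
system is truncated so that its flow is global on `(0, T]`. For each `ε` some `ζ` gives `v(ε) = 0`,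
and a minimum principle keeps `0 ≤ v ≤ x` on `[ε, T]`. Compactness provides a `ζ` good for all `ε`,
and then `|w| ≤ M` removes the truncation (`exists_solution_of_slope`). Different `p` give different
solutions; continuity bounds their number by the continuum. -/

/-! ### Asymptotics at the singular point -/

/-- If `g' ≥ δ / x` as long as `g` lies in `[α, β]`, then `g` leaves `[α, β]` as `x ↘ 0`. -/
theorem eventually_lt_or_forall_le_of_deriv_ge {g g' : ℝ → ℝ} {r δ α β : ℝ} (hδ : 0 < δ)
    (hαβ : α ≤ β)
    (hg : ∀ x ∈ Ioc 0 r, HasDerivAt g (g' x) x)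
    (hg' : ∀ x ∈ Ioc 0 r, α ≤ g x → g x ≤ β → δ / x ≤ g' x) :
    (∀ᶠ x in 𝓝[>] (0 : ℝ), g x < α) ∨ ∀ x ∈ Ioc 0 r, β ≤ g x := by
  -- Since `g' > 0` wherever `g = m`, the level `m` can only be crossed upwards.
  have fence : ∀ m ∈ Icc α β, ∀ x₁ x₂ : ℝ, 0 < x₁ → x₁ ≤ x₂ → x₂ ≤ r → m ≤ g x₁ → m ≤ g x₂ := by
    intro m hm x₁ x₂ h1 h12 h2 hx1
    have hsub : ∀ x ∈ Icc x₁ x₂, x ∈ Ioc 0 r := fun x hx => ⟨h1.trans_le hx.1, hx.2.trans h2⟩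
    have := image_le_of_deriv_right_lt_deriv_boundary (f := fun x => -g x) (f' := fun x => -g' x)
      (a := x₁) (b := x₂) (B := fun _ => -m) (B' := fun _ => 0)
      (fun x hx => (hg x (hsub x hx)).neg.continuousAt.continuousWithinAt)
      (fun x hx => (hg x (hsub x (Ico_subset_Icc_self hx))).neg.hasDerivWithinAt)
      (neg_le_neg hx1) (fun x => hasDerivAt_const _ _)
      (fun x hx hxm => by
        have hx' := hsub x (Ico_subset_Icc_self hx)
        have hxm' : g x = m := neg_injective hxm
        have := hg' x hx' (hxm' ▸ hm.1) (hxm' ▸ hm.2)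
        have := div_pos hδ hx'.1
        linarith) (right_mem_Icc.2 h12)
    simpa using this
  by_contra! hcon
  obtain ⟨hfreq, z, hz, hzβ⟩ := hcon
  have hα : ∀ x ∈ Ioc 0 r, α ≤ g x := by
    intro x hx
    by_contra! hlt
    refine hfreq ?_
    filter_upwards [Ioo_mem_nhdsGT hx.1] with t ht
    by_contra! hle
    exact hlt.not_ge (fence α ⟨le_rfl, hαβ⟩ t x ht.1 ht.2.le hx.2 hle)
  have hβ : ∀ x ∈ Ioc 0 z, g x ≤ β := by
    intro x hx
    by_contra! hlt
    exact hzβ.not_ge (fence β ⟨hαβ, le_rfl⟩ x z hx.1 hx.2 hz.2 hlt.le)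
  have hd : ∀ x ∈ Ioc 0 z, HasDerivAt (fun x => g x - δ * Real.log x) (g' x - δ * x⁻¹) x :=
    fun x hx => (hg x ⟨hx.1, hx.2.trans hz.2⟩).sub
      ((Real.hasDerivAt_log hx.1.ne').const_mul δ)
  have hmono : MonotoneOn (fun x => g x - δ * Real.log x) (Ioc 0 z) := by
    refine monotoneOn_of_hasDerivWithinAt_nonneg (convex_Ioc 0 z)
      (fun x hx => (hd x hx).continuousAt.continuousWithinAt)
      (fun x hx => (hd x (interior_subset hx)).hasDerivWithinAt) (fun x hx => ?_)
    have hx := interior_subset hx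
    have hx' : x ∈ Ioc 0 r := ⟨hx.1, hx.2.trans hz.2⟩
    have := hg' x hx' (hα x hx') (hβ x hx)
    rw [div_eq_mul_inv] at this
    linarith
  -- If `g` stayed in `[α, β]` on `(0, z]`, monotonicity of `g - δ log` would give `g (z e^{-s}) ≤ g
  -- z - δ s = α - 1`.
  set s := (g z - α + 1) / δ with hs
  have hs0 : 0 ≤ s := div_nonneg (by linarith [hα z hz]) hδ.le
  have hxz : z * Real.exp (-s) ≤ z :=
    mul_le_of_le_one_right hz.1.le (Real.exp_le_one_iff.2 (by linarith))
  have hx0 : 0 < z * Real.exp (-s) := mul_pos hz.1 (Real.exp_pos _)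
  have h1 := hmono ⟨hx0, hxz⟩ ⟨hz.1, le_rfl⟩ hxz
  simp only [Real.log_mul hz.1.ne' (Real.exp_pos _).ne', Real.log_exp] at h1
  have h2 := hα _ ⟨hx0, hxz.trans hz.2⟩
  have h3 : δ * s = g z - α + 1 := by rw [hs]; field_simp
  nlinarith

/-- A function vanishing at `0+` with negative derivative is negative. -/
theorem neg_of_tendsto_zero_of_deriv_neg {v w : ℝ → ℝ} {r : ℝ}
    (hv : ∀ x ∈ Ioo 0 r, HasDerivAt v (w x) x) (hv0 : Tendsto v (𝓝[>] 0) (𝓝 0))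
    (hw : ∀ x ∈ Ioo 0 r, w x < 0) : ∀ x ∈ Ioo 0 r, v x < 0 := by
  have hanti : StrictAntiOn v (Ioo 0 r) :=
    strictAntiOn_of_hasDerivWithinAt_neg (convex_Ioo 0 r)
      (fun x hx => (hv x hx).continuousAt.continuousWithinAt)
      (fun x hx => (hv x (interior_subset hx)).hasDerivWithinAt)
      (fun x hx => hw x (interior_subset hx))
  intro x hx
  have hx2 : x / 2 ∈ Ioo 0 r := ⟨by linarith [hx.1], by linarith [hx.1, hx.2]⟩
  have h1 : v x < v (x / 2) := hanti hx2 hx (by linarith [hx.1])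
  have h2 : v (x / 2) ≤ 0 := by
    refine ge_of_tendsto hv0 ?_
    filter_upwards [Ioo_mem_nhdsGT hx2.1] with t ht
    exact (hanti ⟨ht.1, ht.2.trans hx2.2⟩ hx2 ht.2).le
  linarith

/-- Integration of an upper bound `v' ≤ C √x` from `v(0+) = 0`. -/
theorem le_of_tendsto_zero_of_deriv_le {v w : ℝ → ℝ} {r C : ℝ}
    (hv : ∀ x ∈ Ioo 0 r, HasDerivAt v (w x) x) (hv0 : Tendsto v (𝓝[>] 0) (𝓝 0))
    (hw : ∀ x ∈ Ioo 0 r, w x ≤ C * √x) : ∀ x ∈ Ioo 0 r, v x ≤ 2 / 3 * C * (x * √x) := by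
  have hd : ∀ x ∈ Ioo 0 r, HasDerivAt (fun x => v x - 2 / 3 * C * (x * √x))
      (w x - C * √x) x := by
    intro x hx
    have h1 := (hv x hx).sub
      (((hasDerivAt_id x).mul (Real.hasDerivAt_sqrt hx.1.ne')).const_mul (2 / 3 * C))
    refine h1.congr_deriv ?_
    have h2 : 0 < √x := Real.sqrt_pos.2 hx.1
    have h3 : √x * √x = x := Real.mul_self_sqrt hx.1.le
    have h4 : x * (1 / (2 * √x)) = √x / 2 := by
      rw [mul_one_div, div_eq_div_iff (by positivity) two_ne_zero]
      linarith
    simp only [id, h4]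
    ring
  have hanti : AntitoneOn (fun x => v x - 2 / 3 * C * (x * √x)) (Ioo 0 r) := by
    refine antitoneOn_of_deriv_nonpos (convex_Ioo 0 r)
      (fun x hx => (hd x hx).continuousAt.continuousWithinAt)
      (fun x hx => (hd x (interior_subset hx)).differentiableAt.differentiableWithinAt)
      (fun x hx => ?_)
    rw [(hd x (interior_subset hx)).deriv]
    linarith [hw x (interior_subset hx)]
  intro x hx
  have hlim : Tendsto (fun x => v x - 2 / 3 * C * (x * √x)) (𝓝[>] 0) (𝓝 0) := by
    have : Tendsto (fun x : ℝ => 2 / 3 * C * (x * √x)) (𝓝[>] 0) (𝓝 (2 / 3 * C * (0 * √0))) :=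
      (Continuous.tendsto (by fun_prop) 0).mono_left nhdsWithin_le_nhds
    simpa using hv0.sub this
  have : v x - 2 / 3 * C * (x * √x) ≤ 0 := by
    refine ge_of_tendsto hlim ?_
    filter_upwards [Ioo_mem_nhdsGT hx.1] with t ht
    exact hanti ⟨ht.1, ht.2.trans hx.2⟩ hx ht.2.le
  linarith

/-- The slope of a solution `v`, normalised by `√x`, tends to `√((a + b) / c)`. -/
theorem tendsto_slope_div_sqrt {a b c r : ℝ} {v w : ℝ → ℝ} (hc : 0 < c) (hab : 0 < a + b)
    (hr : 0 < r) (hv : ∀ x ∈ Ioo 0 r, HasDerivAt v (w x) x)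
    (hw : ∀ x ∈ Ioo 0 r,
      HasDerivAt w ((c * w x ^ 2 + a * x * w x + b * v x - (a + b) * x) / x ^ 2) x)
    (hv0 : Tendsto v (𝓝[>] 0) (𝓝 0)) (hvx : ∀ x ∈ Ioo 0 r, 0 ≤ v x ∧ v x ≤ x) :
    Tendsto (fun x => w x / √x) (𝓝[>] 0) (𝓝 √((a + b) / c)) := by
  set κ := √((a + b) / c) with hκ
  have hκ0 : 0 < κ := Real.sqrt_pos.2 (div_pos hab hc)
  have hκ2 : c * κ ^ 2 = a + b := by
    rw [hκ, Real.sq_sqrt (div_pos hab hc).le]; field_simp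
  set y := fun x => w x / √x with hy
  set e := fun x => c * y x ^ 2 - (a + b) + (a - 1 / 2) * √x * y x + b * (v x / x) with he
  have hyd : ∀ x ∈ Ioo 0 r, HasDerivAt y (e x / (x * √x)) x := by
    intro x hx
    have h2 : 0 < √x := Real.sqrt_pos.2 hx.1
    have h3 : √x ^ 2 = x := Real.sq_sqrt hx.1.le
    have h1 := (hw x hx).div (Real.hasDerivAt_sqrt hx.1.ne') h2.ne'
    refine h1.congr_deriv ?_
    simp only [he, hy]
    -- Writing `x = s²` turns the claim into an identity of rational functions.
    obtain ⟨s, hs⟩ : ∃ s, s = √x := ⟨_, rfl⟩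
    rw [← hs] at h2 h3 ⊢
    rw [← h3]
    field_simp
    ring
  -- the bound on `y'` in terms of a bound on `e`
  have hstep : ∀ {δ x : ℝ}, 0 < δ → x ∈ Ioo 0 r → x ≤ 1 → δ ≤ e x → δ / x ≤ e x / (x * √x) := by
    intro δ x hδ hx hx1 hle
    have h2 : 0 < √x := Real.sqrt_pos.2 hx.1
    have h3 : √x ≤ 1 := Real.sqrt_le_one.2 hx1
    rw [div_le_div_iff₀ hx.1 (mul_pos hx.1 h2)]
    have : δ * √x ≤ e x := (mul_le_of_le_one_right hδ.le h3).trans hle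
    nlinarith [mul_le_mul_of_nonneg_left this hx.1.le]
  have hquot : ∀ x ∈ Ioo 0 r, |v x / x| ≤ 1 := fun x hx => by
    rw [abs_of_nonneg (div_nonneg (hvx x hx).1 hx.1.le), div_le_one hx.1]; exact (hvx x hx).2
  -- an upper bound on `y`
  obtain ⟨K, hK0, hKev⟩ : ∃ K : ℝ, κ < K ∧ ∀ᶠ x in 𝓝[>] (0 : ℝ), y x < K := by
    -- Chosen so that `y ≥ K` makes `c y²` exceed all other terms of `e` by at least `1`.
    set K := (1 + (a + b) + |b| + |a - 1 / 2|) / c + 1 + κ with hK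
    have hKc : c * (K - 1 - κ) = 1 + (a + b) + |b| + |a - 1 / 2| := by
      rw [hK]; field_simp; ring
    have hKq : 0 ≤ (1 + (a + b) + |b| + |a - 1 / 2|) / c := by positivity
    refine ⟨K, by linarith, ?_⟩
    set ρ := min (r / 2) 1 with hρ
    have hρ0 : 0 < ρ := by positivity
    have hsub : ∀ x ∈ Ioc 0 ρ, x ∈ Ioo 0 r ∧ x ≤ 1 := fun x hx =>
      ⟨⟨hx.1, by linarith [hx.2.trans (min_le_left _ _)]⟩, hx.2.trans (min_le_right _ _)⟩
    have key : ∀ x ∈ Ioc 0 ρ, K ≤ y x → 1 ≤ e x := by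
      intro x hx hxK
      have h3 : √x ≤ 1 := Real.sqrt_le_one.2 (hsub x hx).2
      have h4 : 0 ≤ √x := Real.sqrt_nonneg x
      have h5 : -|b| ≤ b * (v x / x) := by
        refine neg_le_of_abs_le ?_
        rw [abs_mul]; exact mul_le_of_le_one_right (abs_nonneg _) (hquot x (hsub x hx).1)
      have hy1 : 1 ≤ y x := by linarith
      have h6 : -(|a - 1 / 2| * y x) ≤ (a - 1 / 2) * √x * y x := by
        refine neg_le_of_abs_le ?_
        rw [abs_mul, abs_mul, abs_of_nonneg h4, abs_of_nonneg (by linarith : 0 ≤ y x)]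
        exact mul_le_mul_of_nonneg_right (mul_le_of_le_one_right (abs_nonneg _) h3) (by linarith)
      have h7 : 1 + (a + b) + |b| + |a - 1 / 2| ≤ c * y x := by
        rw [← hKc]; exact mul_le_mul_of_nonneg_left (by linarith) hc.le
      have h8 : 1 + (a + b) + |b| ≤ (c * y x - |a - 1 / 2|) * y x := by
        have := abs_nonneg b
        nlinarith
      simp only [he]
      nlinarith
    -- The `y ρ + 1` in `β` makes the second alternative fail at `ρ`.
    rcases eventually_lt_or_forall_le_of_deriv_ge (g := y) (δ := 1) (α := K)
      (β := max K (y ρ + 1)) one_pos (le_max_left _ _) (fun x hx => hyd x (hsub x hx).1)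
      (fun x hx hxK _ => hstep one_pos (hsub x hx).1 (hsub x hx).2 (key x hx hxK)) with h | h
    · exact h
    · have := (le_max_right _ _).trans (h ρ ⟨hρ0, le_rfl⟩)
      linarith
  -- hence `v x / x` tends to zero
  have hvlim : Tendsto (fun x => v x / x) (𝓝[>] 0) (𝓝 0) := by
    obtain ⟨ρ, hρ0, hρ⟩ := mem_nhdsGT_iff_exists_Ioo_subset.1 hKev
    have hb := le_of_tendsto_zero_of_deriv_le (r := min ρ r) (C := K)
      (fun x hx => hv x ⟨hx.1, hx.2.trans_le (min_le_right _ _)⟩) hv0 (fun x hx => by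
        have : y x < K := hρ ⟨hx.1, hx.2.trans_le (min_le_left _ _)⟩
        exact ((div_lt_iff₀ (Real.sqrt_pos.2 hx.1)).1 this).le)
    have hlim : Tendsto (fun x : ℝ => 2 / 3 * K * √x) (𝓝[>] 0) (𝓝 0) := by
      have : Tendsto (fun x : ℝ => 2 / 3 * K * √x) (𝓝[>] 0) (𝓝 (2 / 3 * K * √0)) :=
        (Continuous.tendsto (by fun_prop) 0).mono_left nhdsWithin_le_nhds
      simpa using this
    refine tendsto_of_tendsto_of_tendsto_of_le_of_le' tendsto_const_nhds hlim ?_ ?_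
    · filter_upwards [Ioo_mem_nhdsGT hr] with x hx using div_nonneg (hvx x hx).1 hx.1.le
    · filter_upwards [Ioo_mem_nhdsGT (lt_min hρ0 hr)] with x hx
      rw [div_le_iff₀ hx.1]
      linarith [hb x hx]
  -- the perturbation terms are small
  have hsmall : ∀ η > 0, ∃ ρ > 0, ρ < r ∧ ρ ≤ 1 ∧
      ∀ x ∈ Ioc 0 ρ, ∀ t, |t| ≤ K → |(a - 1 / 2) * √x * t + b * (v x / x)| ≤ η := by
    intro η hη
    have hlim : Tendsto (fun x => |a - 1 / 2| * √x * K + |b| * (v x / x)) (𝓝[>] 0) (𝓝 0) := by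
      have h1 : Tendsto (fun x : ℝ => |a - 1 / 2| * √x * K) (𝓝[>] 0)
          (𝓝 (|a - 1 / 2| * √0 * K)) :=
        (Continuous.tendsto (by fun_prop) 0).mono_left nhdsWithin_le_nhds
      simpa using h1.add (hvlim.const_mul |b|)
    have := hlim.eventually (gt_mem_nhds hη)
    obtain ⟨ρ, hρ0, hρ⟩ := mem_nhdsGT_iff_exists_Ioo_subset.1 this
    have hρ0 : 0 < ρ := hρ0
    have hm1 : min (ρ / 2) (min (r / 2) 1) ≤ ρ / 2 := min_le_left _ _
    have hm2 : min (ρ / 2) (min (r / 2) 1) ≤ r / 2 := (min_le_right _ _).trans (min_le_left _ _)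
    have hm3 : min (ρ / 2) (min (r / 2) 1) ≤ 1 := (min_le_right _ _).trans (min_le_right _ _)
    refine ⟨min (ρ / 2) (min (r / 2) 1), by positivity, by linarith, hm3, fun x hx t ht => ?_⟩
    have h1 : |a - 1 / 2| * √x * K + |b| * (v x / x) < η :=
      hρ ⟨hx.1, by linarith [hx.2]⟩
    have hxr : x ∈ Ioo 0 r := ⟨hx.1, by linarith [hx.2]⟩
    refine (abs_add_le _ _).trans (le_trans (add_le_add ?_ ?_) h1.le)
    · rw [abs_mul, abs_mul, abs_of_nonneg (Real.sqrt_nonneg x)]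
      gcongr
    · rw [abs_mul, abs_of_nonneg (div_nonneg (hvx x hxr).1 hx.1.le)]
  have hupper : ∀ ε > 0, ∀ᶠ x in 𝓝[>] (0 : ℝ), y x < κ + ε := by
    intro ε hε
    rcases le_total K (κ + ε) with hKe | hKe
    · exact hKev.mono fun x hx => hx.trans_le hKe
    -- `c (κ + ε)² - (a + b) ≥ 2 c κ ε`; half of this margin absorbs the perturbation.
    obtain ⟨ρ, hρ0, hρr, hρ1, hρ⟩ := hsmall (c * (κ * ε)) (by positivity)
    have hsub : ∀ x ∈ Ioc 0 ρ, x ∈ Ioo 0 r := fun x hx => ⟨hx.1, hx.2.trans_lt hρr⟩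
    have key : ∀ x ∈ Ioc 0 ρ, κ + ε ≤ y x → y x ≤ K → c * (κ * ε) ≤ e x := by
      intro x hx h1 h2
      have h3 := (abs_le.1 (hρ x hx (y x) (abs_le.2 ⟨by linarith, h2⟩))).1
      have h4 : (κ + ε) ^ 2 ≤ y x ^ 2 := pow_le_pow_left₀ (by positivity) h1 2
      have h5 := mul_le_mul_of_nonneg_left h4 hc.le
      have h6 : 0 ≤ c * ε ^ 2 := by positivity
      simp only [he]
      linarith
    rcases eventually_lt_or_forall_le_of_deriv_ge (g := y) (δ := c * (κ * ε)) (α := κ + ε)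
      (β := K) (by positivity) hKe (fun x hx => hyd x (hsub x hx))
      (fun x hx h1 h2 => hstep (by positivity) (hsub x hx) (hx.2.trans hρ1) (key x hx h1 h2)) with h | h
    · exact h
    · exfalso
      obtain ⟨x, hx1, hx2⟩ := (hKev.and (Ioo_mem_nhdsGT hρ0)).exists
      exact hx1.not_ge (h x ⟨hx2.1, hx2.2.le⟩)
  have hlower : ∀ ε > 0, ε < κ → ∀ᶠ x in 𝓝[>] (0 : ℝ), κ - ε < y x := by
    intro ε hε hεκ
    -- Half of the margin `(a + b) - c (κ - ε)² = c ε (2 κ - ε)`.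
    have hη : 0 < c * (ε * (κ - ε / 2)) := by
      have : 0 < κ - ε / 2 := by linarith
      positivity
    obtain ⟨ρ, hρ0, hρr, hρ1, hρ⟩ := hsmall (c * (ε * (κ - ε / 2))) hη
    have hsub : ∀ x ∈ Ioc 0 ρ, x ∈ Ioo 0 r := fun x hx => ⟨hx.1, hx.2.trans_lt hρr⟩
    have key : ∀ x ∈ Ioc 0 ρ, -(κ - ε) ≤ -y x → -y x ≤ κ - ε →
        c * (ε * (κ - ε / 2)) / x ≤ -(e x / (x * √x)) := by
      intro x hx h1 h2
      have h3 := (abs_le.1 (hρ x hx (y x) (abs_le.2 ⟨by linarith, by linarith⟩))).2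
      have h4 : y x ^ 2 ≤ (κ - ε) ^ 2 := sq_le_sq.2 (by
        rw [abs_of_pos (by linarith : 0 < κ - ε)]
        exact abs_le.2 ⟨by linarith, by linarith⟩)
      have h5 := mul_le_mul_of_nonneg_left h4 hc.le
      have h6 : c * (ε * (κ - ε / 2)) ≤ -e x := by
        simp only [he]
        linarith
      have hx0 := hx.1
      have hs0 : 0 < √x := Real.sqrt_pos.2 hx0
      have hs1 : √x ≤ 1 := Real.sqrt_le_one.2 (hx.2.trans hρ1)
      rw [← neg_div, div_le_div_iff₀ hx0 (mul_pos hx0 hs0)]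
      have : c * (ε * (κ - ε / 2)) * √x ≤ -e x := (mul_le_of_le_one_right hη.le hs1).trans h6
      nlinarith [mul_le_mul_of_nonneg_left this hx0.le]
    rcases eventually_lt_or_forall_le_of_deriv_ge (g := fun x => -y x)
      (δ := c * (ε * (κ - ε / 2))) (α := -(κ - ε))
      (β := κ - ε) hη (by linarith) (fun x hx => (hyd x (hsub x hx)).neg)
      key with h | h
    · exact h.mono fun x hx => by linarith
    -- Here `y ≤ -(κ - ε) < 0` near `0`, so `v` decreases from `0` and becomes negative.
    · exfalso
      have := neg_of_tendsto_zero_of_deriv_neg (r := ρ) (fun x hx => hv x (hsub x ⟨hx.1, hx.2.le⟩))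
        hv0 (fun x hx => by
          have h1 := h x ⟨hx.1, hx.2.le⟩
          have h2 : w x / √x < 0 := by simp only [hy] at h1; linarith
          exact (div_neg_iff.1 h2).elim (fun h => absurd h.2 (Real.sqrt_nonneg x).not_gt)
            (fun h => h.1)) (ρ / 2) ⟨by linarith, by linarith⟩
      linarith [(hvx (ρ / 2) ⟨by linarith, by linarith⟩).1]
  rw [Metric.tendsto_nhds]
  intro ε hε
  have hm : 0 < min ε (κ / 2) := by positivity
  filter_upwards [hupper ε hε, hlower (min ε (κ / 2)) hm
    ((min_le_right _ _).trans_lt (by linarith))] with x h1 h2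
  rw [Real.dist_eq, abs_lt]
  have := min_le_left ε (κ / 2)
  constructor <;> linarith

/-- The asymptotic expansions of a solution, in terms of `v x = x - u x`. -/
theorem isLittleO_of_tendsto_slope_div_sqrt {κ r : ℝ} {v w : ℝ → ℝ} (hr : 0 < r)
    (hv : ∀ x ∈ Ioo 0 r, HasDerivAt v (w x) x) (hv0 : Tendsto v (𝓝[>] 0) (𝓝 0))
    (hlim : Tendsto (fun x => w x / √x) (𝓝[>] 0) (𝓝 κ)) :
    (fun x : ℝ => v x - 2 / 3 * κ * (x * √x)) =o[𝓝[>] 0] (fun x : ℝ => x * √x) ∧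
    (fun x : ℝ => w x - κ * √x) =o[𝓝[>] 0] (fun x : ℝ => √x) := by
  have hw : ∀ ε > 0, ∀ᶠ x in 𝓝[>] (0 : ℝ), |w x - κ * √x| ≤ ε * √x := by
    intro ε hε
    filter_upwards [Metric.tendsto_nhds.1 hlim ε hε, self_mem_nhdsWithin] with x hx hx0
    have hs : 0 < √x := Real.sqrt_pos.2 hx0
    have h1 : w x - κ * √x = (w x / √x - κ) * √x := by field_simp
    rw [h1, abs_mul, abs_of_pos hs]
    exact mul_le_mul_of_nonneg_right (Real.dist_eq _ _ ▸ hx.le) hs.le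
  refine ⟨isLittleO_iff.2 fun ε hε => ?_, isLittleO_iff.2 fun ε hε => ?_⟩
  · obtain ⟨ρ, hρ0, hρ⟩ := mem_nhdsGT_iff_exists_Ioo_subset.1 (hw ε hε)
    have hsub : ∀ x ∈ Ioo 0 (min ρ r), x ∈ Ioo 0 r ∧ |w x - κ * √x| ≤ ε * √x := fun x hx =>
      ⟨⟨hx.1, hx.2.trans_le (min_le_right _ _)⟩, hρ ⟨hx.1, hx.2.trans_le (min_le_left _ _)⟩⟩
    have h1 := le_of_tendsto_zero_of_deriv_le (C := κ + ε) (fun x hx => hv x (hsub x hx).1) hv0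
      (fun x hx => by linarith [(abs_le.1 (hsub x hx).2).2])
    have h2 := le_of_tendsto_zero_of_deriv_le (C := -(κ - ε))
      (fun x hx => (hv x (hsub x hx).1).neg) (by simpa using! hv0.neg)
      (fun x hx => by linarith [(abs_le.1 (hsub x hx).2).1])
    filter_upwards [Ioo_mem_nhdsGT (lt_min hρ0 hr)] with x hx
    have hs : 0 ≤ x * √x := mul_nonneg hx.1.le (Real.sqrt_nonneg x)
    have hs' : 0 ≤ ε * (x * √x) := mul_nonneg hε.le hs
    rw [Real.norm_eq_abs, Real.norm_eq_abs, abs_of_nonneg hs, abs_le]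
    have h1' := h1 x hx
    have h2' : -v x ≤ _ := h2 x hx
    constructor <;> linarith
  · filter_upwards [hw ε hε] with x hx
    rwa [Real.norm_eq_abs, Real.norm_eq_abs, abs_of_nonneg (Real.sqrt_nonneg x)]

/-! ### Backward flow up to a singular time -/

/-- Global backward flow on `(0, T]` of a vector field which is continuous in time and bounded
and Lipschitz in space on each `[ε, T]`. -/
theorem exists_flow_Ioc {E : Type*} [NormedAddCommGroup E] [NormedSpace ℝ E] [CompleteSpace E]
    {f : ℝ → E → E} {T : ℝ} (hT : 0 < T)
    (hlip : ∀ ε, 0 < ε → ∃ K : ℝ≥0, ∀ t ∈ Icc ε T, LipschitzWith K (f t))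
    (hcont : ∀ z, ContinuousOn (f · z) (Ioc 0 T))
    (hbdd : ∀ ε, 0 < ε → ∃ L : ℝ≥0, ∀ t ∈ Icc ε T, ∀ z, ‖f t z‖ ≤ L) :
    ∃ φ : E → ℝ → E, (∀ z, φ z T = z) ∧
      (∀ z, ∀ t ∈ Ioc 0 T, HasDerivWithinAt (φ z) (f t (φ z t)) (Ioc 0 T) t) ∧
      ∀ t ∈ Ioc 0 T, Continuous (φ · t) := by
  have hsub : ∀ {ε}, 0 < ε → Icc ε T ⊆ Ioc 0 T := fun hε x hx => ⟨hε.trans_le hx.1, hx.2⟩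
  have hpl : ∀ ε, 0 < ε → ∀ hε' : ε ≤ T, ∀ z : E, ∃ A L K : ℝ≥0,
      IsPicardLindelof f (⟨T, right_mem_Icc.2 hε'⟩ : Icc ε T) z A 1 L K := by
    intro ε hε hε' z
    obtain ⟨K, hK⟩ := hlip ε hε
    obtain ⟨L, hL⟩ := hbdd ε hε
    -- A solution moves by at most `L (T - ε)`; the extra `1` is the radius of the ball of initial
    -- values, needed for continuity in `z`.
    refine ⟨L * (T - ε).toNNReal + 1, L, K, fun t ht => (hK t ht).lipschitzOnWith,
      fun x _ => (hcont x).mono (hsub hε), fun t ht x _ => hL t ht x, ?_⟩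
    have : (0 : ℝ) ≤ T - ε := by linarith
    simp [this]
  have huniq : ∀ ε, 0 < ε → ∀ g h : ℝ → E,
      (∀ t ∈ Icc ε T, HasDerivWithinAt g (f t (g t)) (Icc ε T) t) →
      (∀ t ∈ Icc ε T, HasDerivWithinAt h (f t (h t)) (Icc ε T) t) → g T = h T →
      EqOn g h (Icc ε T) := by
    intro ε hε g h hg hh hgh
    obtain ⟨K, hK⟩ := hlip ε hε
    have aux : ∀ k : ℝ → E, (∀ t ∈ Icc ε T, HasDerivWithinAt k (f t (k t)) (Icc ε T) t) →
        ∀ t ∈ Ioc ε T, HasDerivWithinAt k (f t (k t)) (Iic t) t := fun k hk t ht =>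
      (hk t (Ioc_subset_Icc_self ht)).mono_of_mem_nhdsWithin
        (mem_of_superset (Icc_mem_nhdsLE ht.1) (Icc_subset_Icc_right ht.2))
    exact ODE_solution_unique_of_mem_Icc_left (v := f) (s := fun _ => univ) (K := K)
      (fun t ht => (hK t (Ioc_subset_Icc_self ht)).lipschitzOnWith)
      (fun t ht => (hg t ht).continuousWithinAt) (aux g hg) (fun _ _ => mem_univ _)
      (fun t ht => (hh t ht).continuousWithinAt) (aux h hh) (fun _ _ => mem_univ _) hgh
  have hex : ∀ (z : E) (ε : ℝ), ∃ α : ℝ → E, 0 < ε → ε ≤ T → α T = z ∧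
      ∀ t ∈ Icc ε T, HasDerivWithinAt α (f t (α t)) (Icc ε T) t := by
    intro z ε
    by_cases h : 0 < ε ∧ ε ≤ T
    · obtain ⟨A, L, K, hp⟩ := hpl ε h.1 h.2 z
      obtain ⟨α, hα⟩ := hp.exists_eq_forall_mem_Icc_hasDerivWithinAt (x := z)
        (Metric.mem_closedBall_self zero_le_one)
      exact ⟨α, fun _ _ => hα⟩
    · exact ⟨0, fun h1 h2 => absurd ⟨h1, h2⟩ h⟩
  choose sol hsol using hex
  have hagree : ∀ z ε, 0 < ε → ∀ t ∈ Icc (2 * ε) T, sol z (t / 2) t = sol z ε t := by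
    intro z ε hε t ht
    have h1 : 0 < t / 2 := by linarith [ht.1]
    have h2 : ε ≤ t / 2 := by linarith [ht.1]
    have h3 : t / 2 ≤ T := by linarith [ht.2]
    have hs := hsol z (t / 2) h1 h3
    have hs' := hsol z ε hε (h2.trans h3)
    exact huniq (t / 2) h1 _ _ hs.2 (fun s hs => (hs'.2 s ⟨h2.trans hs.1, hs.2⟩).mono
      (Icc_subset_Icc_left h2)) (hs.1.trans hs'.1.symm) ⟨by linarith, ht.2⟩
  -- Evaluating at `t` the solution on `[t / 2, T]` keeps `t` off the left end of the interval; by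
  -- uniqueness these solutions agree.
  refine ⟨fun z t => sol z (t / 2) t, fun z =>
    (hsol z (T / 2) (half_pos hT) (half_le_self hT.le)).1, ?_, ?_⟩
  · intro z t ht
    have h4 : 0 < t / 4 := by linarith [ht.1]
    have hmem : t ∈ Icc (2 * (t / 4)) T := ⟨by linarith, ht.2⟩
    have hd := (hsol z (t / 4) h4 (by linarith [ht.2])).2 t ⟨by linarith, ht.2⟩
    beta_reduce
    rw [hagree z (t / 4) h4 t hmem]
    have hd' : HasDerivWithinAt (sol z (t / 4)) (f t (sol z (t / 4) t)) (Ioc 0 T) t := by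
      refine hd.mono_of_mem_nhdsWithin ?_
      filter_upwards [self_mem_nhdsWithin, mem_nhdsWithin_of_mem_nhds
        (Ioi_mem_nhds (show t / 4 < t by linarith))] with s hs hs'
      exact ⟨le_of_lt hs', hs.2⟩
    refine hd'.congr_of_eventuallyEq ?_ (hagree z (t / 4) h4 t hmem)
    filter_upwards [self_mem_nhdsWithin, mem_nhdsWithin_of_mem_nhds
      (Ioi_mem_nhds (show 2 * (t / 4) < t by linarith))] with s hs hs'
    exact hagree z (t / 4) h4 s ⟨le_of_lt hs', hs.2⟩
  · intro t ht
    have h4 : 0 < t / 4 := by linarith [ht.1]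
    have h4' : t / 4 ≤ T := by linarith [ht.2, ht.1]
    rw [continuous_iff_continuousAt]
    intro z
    obtain ⟨A, L, K, hp⟩ := hpl (t / 4) h4 h4' z
    obtain ⟨α, hα, L', hL'⟩ :=
      hp.exists_forall_mem_closedBall_eq_hasDerivWithinAt_lipschitzOnWith
    have ht4 : t ∈ Icc (t / 4) T := ⟨by linarith, ht.2⟩
    have hball : Metric.closedBall z ((1 : ℝ≥0) : ℝ) ∈ 𝓝 z :=
      Metric.closedBall_mem_nhds z (by simp)
    refine ((hL' t ht4).continuousOn.continuousAt hball).congr ?_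
    filter_upwards [hball] with y hy
    rw [hagree y (t / 4) h4 t ⟨by linarith, ht.2⟩]
    exact huniq (t / 4) h4 _ _ (hα y hy).2 (hsol y _ h4 h4').2
      ((hα y hy).1.trans (hsol y _ h4 h4').1.symm) ht4

/-! ### Minimum principle -/

/-- At a local minimum the second derivative is nonnegative. -/
theorem nonneg_of_isLocalMin_of_hasDerivAt {f g : ℝ → ℝ} {x d : ℝ}
    (hf : ∀ᶠ y in 𝓝 x, HasDerivAt f (g y) y) (hg : HasDerivAt g d x) (hmin : IsLocalMin f x) :
    0 ≤ d := by
  by_contra! hd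
  have hdf : deriv f =ᶠ[𝓝 x] g := hf.mono fun y hy => hy.deriv
  have hg0 : g x = 0 := hmin.hasDerivAt_eq_zero hf.self_of_nhds
  have hneg : deriv (fun y => -f y) =ᶠ[𝓝 x] fun y => -g y := hf.mono fun y hy => hy.neg.deriv
  -- If `d < 0`, the second derivative test makes `x` a local maximum too, so `f` is locally
  -- constant and `d = 0`.
  have hmax : IsLocalMin (fun y => -f y) x := by
    refine isLocalMin_of_deriv_deriv_pos ?_ ?_ ?_
    · rw [hneg.deriv_eq, hg.fun_neg.deriv]; linarith
    · rw [hneg.eq_of_nhds, hg0, neg_zero]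
    · exact hf.self_of_nhds.continuousAt.neg
  have hconst : f =ᶠ[𝓝 x] fun _ => f x := by
    filter_upwards [hmin, hmax] with y h1 h2
    exact le_antisymm (neg_le_neg_iff.1 h2) h1
  have h0 : g =ᶠ[𝓝 x] fun _ => 0 := by
    refine hdf.symm.trans (hconst.deriv.trans ?_)
    simp
  have := h0.deriv_eq
  rw [hg.deriv] at this
  simp at this
  linarith

/-- A minimum principle: no negative interior minimum, nonnegative value at the left end and
positive slope at the right end. -/
theorem nonneg_of_minimum_principle {h g : ℝ → ℝ} {ε T : ℝ} (hεT : ε < T)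
    (hd : ∀ x ∈ Icc ε T, HasDerivWithinAt h (g x) (Icc ε T) x) (hε : 0 ≤ h ε) (hT : 0 < g T)
    (hint : ∀ x ∈ Ioo ε T, h x < 0 → g x = 0 → ∃ d < 0, HasDerivAt g d x) :
    ∀ x ∈ Icc ε T, 0 ≤ h x := by
  obtain ⟨m, hm, hmin⟩ := isCompact_Icc.exists_isMinOn (nonempty_Icc.2 hεT.le)
    (fun x hx => (hd x hx).continuousWithinAt : ContinuousOn h (Icc ε T))
  suffices 0 ≤ h m from fun x hx => this.trans (hmin hx)
  by_contra! hneg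
  have hmε : ε < m := lt_of_le_of_ne hm.1 (by rintro rfl; linarith)
  rcases hm.2.eq_or_lt with rfl | hmT
  · have h1 : HasDerivWithinAt h (g m) (Iic m) m :=
      (hd m hm).mono_of_mem_nhdsWithin (Icc_mem_nhdsLE hmε)
    have h2 : ∀ᶠ z in 𝓝[<] m, 0 < slope h m z :=
      ((hasDerivWithinAt_iff_tendsto_slope' self_notMem_Iio).1
        (h1.mono Iio_subset_Iic_self)).eventually (lt_mem_nhds hT)
    obtain ⟨z, hz1, hz2⟩ := (h2.and (Ioo_mem_nhdsLT hmε)).exists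
    rw [slope_def_field, div_pos_iff] at hz1
    have := hmin (show z ∈ Icc ε m from ⟨hz2.1.le, hz2.2.le⟩)
    have h3 : h m ≤ h z := this
    rcases hz1 with hz1 | hz1 <;> linarith [hz2.2]
  · have hloc : ∀ᶠ y in 𝓝 m, HasDerivAt h (g y) y := by
      filter_upwards [Ioo_mem_nhds hmε hmT] with y hy
      exact (hd y (Ioo_subset_Icc_self hy)).hasDerivAt (Icc_mem_nhds hy.1 hy.2)
    have hlm : IsLocalMin h m := hmin.isLocalMin (Icc_mem_nhds hmε hmT)
    obtain ⟨d, hd0, hgd⟩ := hint m ⟨hmε, hmT⟩ hneg (hlm.hasDerivAt_eq_zero hloc.self_of_nhds)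
    exact hd0.not_ge (nonneg_of_isLocalMin_of_hasDerivAt hloc hgd hlm)

/-! ### Truncated system and a priori bounds -/

/-- Truncation of a real number to `[-M, M]`. -/
def clip (M s : ℝ) : ℝ := max (min s M) (-M)

theorem abs_clip_le {M : ℝ} (hM : 0 ≤ M) (s : ℝ) : |clip M s| ≤ M :=
  abs_le.2 ⟨le_max_right _ _, max_le (min_le_right _ _) (by linarith)⟩

theorem clip_of_mem {M s : ℝ} (h1 : -M ≤ s) (h2 : s ≤ M) : clip M s = s := by
  rw [clip, min_eq_left h2, max_eq_left h1]

theorem clip_of_le_neg {M s : ℝ} (hM : 0 ≤ M) (h : s ≤ -M) : clip M s = -M := by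
  rw [clip, min_eq_left (by linarith), max_eq_right h]

theorem eq_of_clip_eq {M s t : ℝ} (ht : |t| < M) (h : clip M s = t) : s = t := by
  rw [abs_lt] at ht
  unfold clip at h
  grind

theorem abs_clip_sub_clip_le (M s t : ℝ) : |clip M s - clip M t| ≤ |s - t| := by
  have : LipschitzWith 1 (clip M) := (LipschitzWith.id.min_const M).max_const (-M)
  simpa [Real.dist_eq] using this.dist_le_mul s t

theorem clip_eventuallyEq {M s : ℝ} (hs : |s| < M) : ∀ᶠ t in 𝓝 s, clip M t = t := by
  rw [abs_lt] at hs
  filter_upwards [Ioo_mem_nhds hs.1 hs.2] with t ht using clip_of_mem ht.1.le ht.2.le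

/-- The right-hand side of the equation `x² w' = c w² + a x w + b v - (a + b) x`. -/
noncomputable def slopeField (a b c x v w : ℝ) : ℝ :=
  (c * w ^ 2 + a * x * w + b * v - (a + b) * x) / x ^ 2

/-- The first order system for `(v, w)`, truncated to `v ∈ [0, x]` and `w ∈ [-M, M]`. -/
noncomputable def truncatedField (a b c M x : ℝ) (z : ℝ × ℝ) : ℝ × ℝ :=
  (clip M z.2, slopeField a b c x (max (min z.1 x) 0) (clip M z.2))

/-- Truncation makes the field bounded and globally Lipschitz in `(v, w)` on each `[ε, T]`, so
backward solutions cannot blow up before reaching `0`. -/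
theorem exists_truncatedField_flow (a b c : ℝ) {M T : ℝ} (hM : 0 ≤ M) (hT : 0 < T) :
    ∃ φ : ℝ × ℝ → ℝ → ℝ × ℝ, (∀ z, φ z T = z) ∧
      (∀ z, ∀ t ∈ Ioc 0 T,
        HasDerivWithinAt (φ z) (truncatedField a b c M t (φ z t)) (Ioc 0 T) t) ∧
      ∀ t ∈ Ioc 0 T, Continuous (φ · t) := by
  refine exists_flow_Ioc hT (fun ε hε => ?_) (fun z => ?_) (fun ε hε => ?_)
  · refine ⟨(1 + (2 * |c| * M + |a| * T + |b|) / ε ^ 2).toNNReal, fun t ht => ?_⟩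
    refine LipschitzWith.of_dist_le_mul fun y z => ?_
    have ht0 : 0 < t := hε.trans_le ht.1
    have hC : 0 ≤ (2 * |c| * M + |a| * T + |b|) / ε ^ 2 := by positivity
    rw [Real.coe_toNNReal _ (by positivity)]
    have h1 : |y.1 - z.1| ≤ dist y z := (Real.dist_eq _ _ ▸ le_max_left _ _ : _)
    have h2 : |y.2 - z.2| ≤ dist y z := (Real.dist_eq _ _ ▸ le_max_right _ _ : _)
    have h3 := (abs_clip_sub_clip_le M y.2 z.2).trans h2
    have h4 : |max (min y.1 t) 0 - max (min z.1 t) 0| ≤ dist y z := by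
      have : LipschitzWith 1 fun s : ℝ => max (min s t) 0 :=
        (LipschitzWith.id.min_const t).max_const 0
      have := this.dist_le_mul y.1 z.1
      simp only [Real.dist_eq, NNReal.coe_one, one_mul] at this
      exact this.trans h1
    have hd := dist_nonneg (x := y) (y := z)
    refine (Prod.dist_eq (x := truncatedField a b c M t y)).trans_le (max_le ?_ ?_)
    · rw [Real.dist_eq]
      refine h3.trans ?_
      nlinarith
    · rw [Real.dist_eq]
      simp only [truncatedField, slopeField]
      set W := clip M y.2
      set W' := clip M z.2
      set V := max (min y.1 t) 0
      set V' := max (min z.1 t) 0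
      have h5 : |W + W'| ≤ 2 * M :=
        (abs_add_le _ _).trans (by linarith [abs_clip_le hM y.2, abs_clip_le hM z.2])
      have h6 : (c * W ^ 2 + a * t * W + b * V - (a + b) * t) / t ^ 2 -
          (c * W' ^ 2 + a * t * W' + b * V' - (a + b) * t) / t ^ 2 =
          (c * (W + W') * (W - W') + a * t * (W - W') + b * (V - V')) / t ^ 2 := by ring
      have h7 : |c * (W + W') * (W - W') + a * t * (W - W') + b * (V - V')| ≤
          (2 * |c| * M + |a| * T + |b|) * dist y z := by
        have e1 : |c * (W + W') * (W - W')| ≤ |c| * (2 * M) * dist y z := by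
          rw [abs_mul, abs_mul]; gcongr
        have e2 : |a * t * (W - W')| ≤ |a| * T * dist y z := by
          rw [abs_mul, abs_mul, abs_of_pos ht0]; gcongr; exact ht.2
        have e3 : |b * (V - V')| ≤ |b| * dist y z := by
          rw [abs_mul]; gcongr
        have := abs_add_three (c * (W + W') * (W - W')) (a * t * (W - W')) (b * (V - V'))
        linarith
      rw [h6, abs_div, abs_of_pos (by positivity : 0 < t ^ 2)]
      calc _ ≤ (2 * |c| * M + |a| * T + |b|) * dist y z / ε ^ 2 := by
            gcongr; exact ht.1
        _ ≤ _ := by rw [mul_div_right_comm]; nlinarith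
  · unfold truncatedField slopeField
    refine continuousOn_const.prodMk (ContinuousOn.div (Continuous.continuousOn (by fun_prop))
      (by fun_prop) fun x hx => (pow_pos hx.1 2).ne')
  · refine ⟨(M + (|c| * M ^ 2 + |a| * T * M + |b| * T + |a + b| * T) / ε ^ 2).toNNReal,
      fun t ht z => ?_⟩
    have ht0 : 0 < t := hε.trans_le ht.1
    have hT0 : 0 < T := hT
    have hC : 0 ≤ (|c| * M ^ 2 + |a| * T * M + |b| * T + |a + b| * T) / ε ^ 2 := by positivity
    rw [Real.coe_toNNReal _ (by positivity), Prod.norm_def]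
    have hW := abs_clip_le hM z.2
    refine max_le ?_ ?_
    · rw [Real.norm_eq_abs]; exact hW.trans (by linarith)
    · rw [Real.norm_eq_abs]
      simp only [truncatedField, slopeField]
      set W := clip M z.2
      set V := max (min z.1 t) 0 with hV
      have hV0 : |V| ≤ T := by
        rw [abs_of_nonneg (le_max_right _ _)]
        exact max_le ((min_le_right _ _).trans ht.2) hT0.le
      have h7 : |c * W ^ 2 + a * t * W + b * V - (a + b) * t| ≤
          |c| * M ^ 2 + |a| * T * M + |b| * T + |a + b| * T := by
        have e1 : |c * W ^ 2| ≤ |c| * M ^ 2 := by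
          rw [abs_mul, abs_pow]; gcongr
        have e2 : |a * t * W| ≤ |a| * T * M := by
          rw [abs_mul, abs_mul, abs_of_pos ht0]; gcongr; exact ht.2
        have e3 : |b * V| ≤ |b| * T := by
          rw [abs_mul]; gcongr
        have e4 : |(a + b) * t| ≤ |a + b| * T := by
          rw [abs_mul, abs_of_pos ht0]; gcongr; exact ht.2
        have := abs_add_three (c * W ^ 2) (a * t * W) (b * V)
        have := abs_sub (c * W ^ 2 + a * t * W + b * V) ((a + b) * t)
        linarith
      rw [abs_div, abs_of_pos (by positivity : 0 < t ^ 2)]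
      calc _ ≤ (|c| * M ^ 2 + |a| * T * M + |b| * T + |a + b| * T) / ε ^ 2 := by
            gcongr; exact ht.1
        _ ≤ _ := by linarith

section truncated

variable {a b c M T : ℝ} {v w : ℝ → ℝ}

/-- Solutions of the truncated system do not leave the region `0 ≤ v ≤ x`. -/
theorem mem_Icc_of_truncated (hc : 0 < c) (hab : 0 < a + b) (hM : 1 < M) {ε : ℝ} (hε : 0 < ε)
    (hεT : ε < T)
    (hv : ∀ x ∈ Ioc 0 T, HasDerivWithinAt v (clip M (w x)) (Ioc 0 T) x)
    (hw : ∀ x ∈ Ioc 0 T, HasDerivWithinAt w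
      (slopeField a b c x (max (min (v x) x) 0) (clip M (w x))) (Ioc 0 T) x)
    (hwT : w T ∈ Ioo 0 1) (hvε : v ε ∈ Icc 0 ε) : ∀ x ∈ Icc ε T, 0 ≤ v x ∧ v x ≤ x := by
  have hsub : Icc ε T ⊆ Ioc 0 T := fun x hx => ⟨hε.trans_le hx.1, hx.2⟩
  have hwI : ∀ x ∈ Ioo ε T, HasDerivAt w
      (slopeField a b c x (max (min (v x) x) 0) (clip M (w x))) x := fun x hx =>
    (hw x (hsub (Ioo_subset_Icc_self hx))).hasDerivAt
      (Ioc_mem_nhds (hε.trans hx.1) hx.2)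
  have hclip : ∀ x ∈ Ioo ε T, ∀ d, |w x| < M → HasDerivAt w d x →
      HasDerivAt (fun x => clip M (w x)) d x := fun x hx d hwx hd =>
    hd.congr_of_eventuallyEq (hd.continuousAt.eventually (clip_eventuallyEq hwx))
  have hclipT : clip M (w T) = w T := clip_of_mem (by linarith [hwT.1]) (by linarith [hwT.2])
  -- At a negative critical point of `v`, `w = 0` and the truncated `v` is `0`, so `x² w' = -(a + b)
  -- x < 0`.
  have h0 := nonneg_of_minimum_principle (h := v) (g := fun x => clip M (w x)) hεT
    (fun x hx => (hv x (hsub hx)).mono hsub) hvε.1 (by rw [hclipT]; exact hwT.1) (fun x hx hneg hgx => by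
      have hx0 : 0 < x := hε.trans hx.1
      have hwx : w x = 0 := eq_of_clip_eq (by simp; linarith) hgx
      refine ⟨_, ?_, hclip x hx _ (by simp [hwx]; linarith) (hwI x hx)⟩
      rw [max_eq_right ((min_le_left _ _).trans hneg.le), hgx, slopeField]
      refine div_neg_of_neg_of_pos ?_ (by positivity)
      nlinarith)
  -- At a negative critical point of `x - v`, `w = 1` and the truncated `v` is `x`: the linear terms
  -- cancel and `x² w' = c > 0`.
  have h1 := nonneg_of_minimum_principle (h := fun x => x - v x)
    (g := fun x => 1 - clip M (w x)) hεT
    (fun x hx => (hasDerivWithinAt_id x _).sub ((hv x (hsub hx)).mono hsub))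
    (by linarith [hvε.2]) (by rw [hclipT]; linarith [hwT.2]) (fun x hx hneg hgx => by
      have hx0 : 0 < x := hε.trans hx.1
      have hgx' : clip M (w x) = 1 := by linarith
      have hwx : w x = 1 := eq_of_clip_eq (by simpa using hM) hgx'
      refine ⟨_, ?_, (hclip x hx _ (by simpa [hwx] using hM) (hwI x hx)).const_sub 1⟩
      rw [min_eq_right (by linarith), max_eq_left hx0.le, hgx', slopeField, neg_lt_zero]
      refine div_pos ?_ (by positivity)
      linarith)
  exact fun x hx => ⟨h0 x hx, sub_nonneg.1 (h1 x hx)⟩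

/-- If `M` is large, solutions of the truncated system in the region `0 ≤ v ≤ x` on all of
`(0, T]` have slopes in `[-M, M]`. -/
theorem abs_slope_le_of_truncated (hM : 1 < M)
    (hcM : (|a| + |b| + |a + b|) * T < c * M)
    (hv : ∀ x ∈ Ioc 0 T, HasDerivWithinAt v (clip M (w x)) (Ioc 0 T) x)
    (hw : ∀ x ∈ Ioc 0 T, HasDerivWithinAt w
      (slopeField a b c x (max (min (v x) x) 0) (clip M (w x))) (Ioc 0 T) x)
    (hwT : w T < 1) (hvx : ∀ x ∈ Ioc 0 T, 0 ≤ v x ∧ v x ≤ x) :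
    ∀ x ∈ Ioc 0 T, -M ≤ w x ∧ w x ≤ M := by
  -- At `w = ±M` the term `c M²` dominates, so both levels are crossed only upwards.
  have hfield : ∀ x ∈ Ioc 0 T, ∀ s, |s| = M →
      0 < slopeField a b c x (max (min (v x) x) 0) s := by
    intro x hx s hs
    have hT : 0 < T := hx.1.trans_le hx.2
    rw [min_eq_left (hvx x hx).2, max_eq_left (hvx x hx).1, slopeField]
    refine div_pos ?_ (pow_pos hx.1 2)
    have e0 : s ^ 2 = M ^ 2 := by rw [← hs, sq_abs]
    have e1 : |a * x * s| ≤ |a| * T * M := by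
      rw [abs_mul, abs_mul, abs_of_pos hx.1, hs]
      have := hx.2
      gcongr
    have e2 : |b * v x| ≤ |b| * T * M := by
      rw [abs_mul, abs_of_nonneg (hvx x hx).1, mul_assoc]
      have := (hvx x hx).2.trans hx.2
      refine mul_le_mul_of_nonneg_left ?_ (abs_nonneg _)
      nlinarith
    have e3 : |(a + b) * x| ≤ |a + b| * T * M := by
      rw [abs_mul, abs_of_pos hx.1, mul_assoc]
      have := hx.2
      refine mul_le_mul_of_nonneg_left ?_ (abs_nonneg _)
      nlinarith
    have e4 : (|a| + |b| + |a + b|) * T * M < c * M * M :=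
      mul_lt_mul_of_pos_right hcM (by linarith)
    rw [e0]
    have := (abs_le.1 e1).1
    have := (abs_le.1 e2).1
    have := (abs_le.1 e3).2
    nlinarith
  have fence : ∀ m, |m| = M → ∀ x₁ x₂ : ℝ, 0 < x₁ → x₁ ≤ x₂ → x₂ ≤ T → m ≤ w x₁ → m ≤ w x₂ := by
    intro m hm x₁ x₂ h1 h12 h2 hx1
    have hsub : ∀ x ∈ Icc x₁ x₂, x ∈ Ioc 0 T := fun x hx => ⟨h1.trans_le hx.1, hx.2.trans h2⟩
    have := image_le_of_deriv_right_lt_deriv_boundary (f := fun x => -w x)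
      (f' := fun x => -slopeField a b c x (max (min (v x) x) 0) (clip M (w x)))
      (a := x₁) (b := x₂) (B := fun _ => -m) (B' := fun _ => 0)
      (fun x hx => ((hw x (hsub x hx)).neg.mono (fun y hy => hsub y hy)).continuousWithinAt)
      (fun x hx => (hw x (hsub x (Ico_subset_Icc_self hx))).neg.mono_of_mem_nhdsWithin
        (mem_of_superset (Icc_mem_nhdsGE hx.2) fun y hy =>
          hsub y ⟨hx.1.trans hy.1, hy.2⟩))
      (neg_le_neg hx1) (fun x => hasDerivAt_const _ _)
      (fun x hx hxm => by
        have hxm' : w x = m := neg_injective hxm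
        have hcl : clip M (w x) = m := by
          have := abs_le.1 hm.le
          rw [hxm', clip_of_mem this.1 this.2]
        rw [hcl]
        exact neg_lt_zero.2 (hfield x (hsub x (Ico_subset_Icc_self hx)) m hm))
      (right_mem_Icc.2 h12)
    simpa using this
  have hMabs : |M| = M := abs_of_pos (by linarith)
  intro x hx
  refine ⟨?_, ?_⟩
  -- If `w x < -M`, then `w ≤ -M` and `v' = -M` on all of `(0, x]`, so `v (x / 4) ≥ 3 M x / 4 > x /
  -- 4`.
  · by_contra! hlt
    have hle : ∀ t ∈ Ioc 0 x, w t ≤ -M := by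
      intro t ht
      by_contra! h
      exact hlt.not_ge (fence (-M) (by rw [abs_neg, hMabs]) t x ht.1 ht.2 hx.2 h.le)
    have hd : ∀ t ∈ Ioc 0 x, HasDerivWithinAt (fun t => v t + M * t) 0 (Ioc 0 x) t := by
      intro t ht
      have h1 := (hv t ⟨ht.1, ht.2.trans hx.2⟩).mono (Ioc_subset_Ioc_right hx.2)
      rw [clip_of_le_neg (by linarith) (hle t ht)] at h1
      exact (h1.add ((hasDerivWithinAt_id t _).const_mul M)).congr_deriv (by simp)
    have hconst := (convex_Ioc 0 x).is_const_of_fderivWithin_eq_zero (𝕜 := ℝ)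
      (f := fun t => v t + M * t) (fun t ht => (hd t ht).differentiableWithinAt)
      (fun t ht => by
        have hu : UniqueDiffWithinAt ℝ (Ioc 0 x) t := uniqueDiffOn_Ioc 0 x t ht
        rw [(hd t ht).hasFDerivWithinAt.fderivWithin hu]; ext; simp)
      (show x / 4 ∈ Ioc 0 x from ⟨by linarith [hx.1], by linarith [hx.1]⟩)
      (show x ∈ Ioc 0 x from ⟨hx.1, le_rfl⟩)
    have h1 := (hvx (x / 4) ⟨by linarith [hx.1], by linarith [hx.1, hx.2]⟩).2
    have h2 := (hvx x hx).1
    nlinarith [hx.1]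
  · by_contra! hgt
    have := fence M hMabs x T hx.1 hx.2 le_rfl hgt.le
    linarith

end truncated

/-! ### Shooting -/

/-- For every `p ∈ (0, 1)` there is a solution in the region `0 ≤ v ≤ x` with slope `p` at `T`. -/
theorem exists_solution_of_slope {a b c T p : ℝ} (hc : 0 < c) (hab : 0 < a + b) (hT : 0 < T)
    (hp : p ∈ Ioo 0 1) :
    ∃ v w : ℝ → ℝ, w T = p ∧ (∀ x ∈ Ioc 0 T, HasDerivWithinAt v (w x) (Ioc 0 T) x ∧
      HasDerivWithinAt w (slopeField a b c x (v x) (w x)) (Ioc 0 T) x ∧ 0 ≤ v x ∧ v x ≤ x) := by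
  obtain ⟨M, hM, hcM⟩ : ∃ M, 1 < M ∧ (|a| + |b| + |a + b|) * T < c * M := by
    refine ⟨2 + (|a| + |b| + |a + b|) * T / c, ?_, ?_⟩
    · have : 0 ≤ (|a| + |b| + |a + b|) * T / c := by positivity
      linarith
    · rw [mul_add, mul_div_cancel₀ _ hc.ne']
      linarith
  obtain ⟨φ, hφT, hφd, hφc⟩ := exists_truncatedField_flow a b c (M := M) (by linarith) hT
  have hv : ∀ z, ∀ x ∈ Ioc 0 T,
      HasDerivWithinAt (fun x => (φ z x).1) (clip M (φ z x).2) (Ioc 0 T) x := fun z x hx =>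
    (hφd z x hx).hasFDerivWithinAt.fst.hasDerivWithinAt.congr_deriv (by simp [truncatedField])
  have hw : ∀ z, ∀ x ∈ Ioc 0 T, HasDerivWithinAt (fun x => (φ z x).2)
      (slopeField a b c x (max (min (φ z x).1 x) 0) (clip M (φ z x).2)) (Ioc 0 T) x :=
    fun z x hx =>
      (hφd z x hx).hasFDerivWithinAt.snd.hasDerivWithinAt.congr_deriv (by simp [truncatedField])
  have hcontv : ∀ x ∈ Ioc 0 T, Continuous fun ζ => (φ (ζ, p) x).1 := fun x hx =>
    continuous_fst.comp ((hφc x hx).comp (by fun_prop))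
  -- End values `ζ = v(T)` whose solution stays in the region down to `T / (n + 2)`; the shift by
  -- `2` keeps this point below `T` for `n = 0`.
  let Z : ℕ → Set ℝ := fun n =>
    {ζ | ∀ x ∈ Icc (T / (n + 2)) T, 0 ≤ (φ (ζ, p) x).1 ∧ (φ (ζ, p) x).1 ≤ x}
  have hpos : ∀ n : ℕ, 0 < T / ((n : ℝ) + 2) := fun n => by positivity
  have hltT : ∀ n : ℕ, T / ((n : ℝ) + 2) < T := fun n =>
    div_lt_self hT (by have : (0 : ℝ) ≤ n := n.cast_nonneg
                       linarith)
  have hZc : ∀ n, IsClosed (Z n) := by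
    intro n
    simp only [Z, Set.ofPred_forall]
    refine isClosed_iInter fun x => isClosed_iInter fun hx => ?_
    have := hcontv x ⟨(hpos n).trans_le hx.1, hx.2⟩
    exact (isClosed_le continuous_const this).inter (isClosed_le this continuous_const)
  have hZanti : ∀ n, Z (n + 1) ⊆ Z n := by
    intro n ζ hζ x hx
    refine hζ x ⟨le_trans ?_ hx.1, hx.2⟩
    push_cast
    gcongr
    linarith
  have hZcomp : IsCompact (Z 0) := by
    refine isCompact_Icc.of_isClosed_subset (hZc 0) (fun ζ hζ => ?_ : Z 0 ⊆ Icc 0 T)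
    have := hζ T ⟨(hltT 0).le, le_rfl⟩
    simpa [hφT] using this
  have hZne : ∀ n, (Z n).Nonempty := by
    intro n
    set ε := T / ((n : ℝ) + 2) with hε
    have hε0 : 0 < ε := hpos n
    have hεT : ε < T := hltT n
    have hεmem : ε ∈ Ioc 0 T := ⟨hε0, hεT.le⟩
    have hbound : ∀ ζ, |(φ (ζ, p) T).1 - (φ (ζ, p) ε).1| ≤ M * T := by
      intro ζ
      have := (convex_Ioc 0 T).norm_image_sub_le_of_norm_hasDerivWithin_le (hv (ζ, p))
        (fun x _ => abs_clip_le (by linarith) _) hεmem ⟨hT, le_rfl⟩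
      rw [Real.norm_eq_abs, Real.norm_eq_abs, abs_of_pos (sub_pos.2 hεT)] at this
      nlinarith
    have hlo := abs_le.1 (hbound (-(M * T)))
    have hhi := abs_le.1 (hbound (M * T))
    rw [hφT] at hlo hhi
    have hMT : 0 ≤ M * T := by nlinarith
    -- Between `ε` and `T`, `v` changes by at most `M T`, so `v(ε)` is `≤ 0` for `ζ = -M T` and `≥
    -- 0` for `ζ = M T`.
    obtain ⟨ζ, -, hζ⟩ := intermediate_value_Icc (by linarith : -(M * T) ≤ M * T)
      (hcontv ε hεmem).continuousOn
      (show (0 : ℝ) ∈ _ from ⟨by linarith [hlo.1], by linarith [hhi.2]⟩)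
    refine ⟨ζ, mem_Icc_of_truncated hc hab hM hε0 hεT (hv _) (hw _) ?_ ?_⟩
    · simpa [hφT] using hp
    · have hζ' : (φ (ζ, p) ε).1 = 0 := hζ
      exact ⟨hζ'.ge, hζ'.le.trans hε0.le⟩
  obtain ⟨ζ, hζ⟩ := IsCompact.nonempty_iInter_of_sequence_nonempty_isCompact_isClosed Z hZanti hZne
    hZcomp hZc
  have hmem : ∀ x ∈ Ioc 0 T, 0 ≤ (φ (ζ, p) x).1 ∧ (φ (ζ, p) x).1 ≤ x := by
    intro x hx
    obtain ⟨n, hn⟩ := exists_nat_gt (T / x)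
    refine mem_iInter.1 hζ n x ⟨?_, hx.2⟩
    rw [div_lt_iff₀ hx.1] at hn
    rw [div_le_iff₀ (by positivity)]
    nlinarith [hx.1]
  have hslope := abs_slope_le_of_truncated hM hcM (hv _) (hw _) (by simpa [hφT] using hp.2) hmem
  refine ⟨fun x => (φ (ζ, p) x).1, fun x => (φ (ζ, p) x).2, by simp [hφT], fun x hx => ?_⟩
  have h1 := hv (ζ, p) x hx
  have h2 := hw (ζ, p) x hx
  rw [clip_of_mem (hslope x hx).1 (hslope x hx).2] at h1 h2
  rw [min_eq_left (hmem x hx).2, max_eq_left (hmem x hx).1] at h2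
  exact ⟨h1, h2, hmem x hx⟩

/-- A family of solutions with prescribed one-sided derivative at the right end point. -/
theorem exists_boundedLocalSolution_of_slope {a b c T q : ℝ} (hc : 0 < c) (hab : 0 < a + b)
    (hT : 0 < T) (hq : q ∈ Ioo 0 1) :
    ∃ u ∈ boundedLocalSolutions a b c T, HasDerivWithinAt u q (Ioc 0 T) T := by
  obtain ⟨v, w, hwT, hvw⟩ := exists_solution_of_slope (p := 1 - q) hc hab hT
    ⟨by linarith [hq.2], by linarith [hq.1]⟩
  -- Nothing is known about `v 0`, so the value at `0` is imposed; continuity there follows from `0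
  -- ≤ u x ≤ x`.
  set u : ℝ → ℝ := fun x => if 0 < x then x - v x else 0 with hu
  have hupos : ∀ {x}, 0 < x → u x = x - v x := fun hx => if_pos hx
  have hu0 : u 0 = 0 := if_neg (lt_irrefl 0)
  have hbd : ∀ x ∈ Icc 0 T, 0 ≤ u x ∧ u x ≤ x := by
    intro x hx
    rcases hx.1.eq_or_lt with rfl | h
    · simp [hu0]
    · rw [hupos h]
      have := (hvw x ⟨h, hx.2⟩).2.2
      constructor <;> linarith
  have hud : ∀ x ∈ Ioc 0 T, HasDerivWithinAt u (1 - w x) (Ioc 0 T) x := fun x hx =>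
    ((hasDerivWithinAt_id x _).sub (hvw x hx).1).congr (fun y hy => hupos hy.1) (hupos hx.1)
  have hnhds : ∀ x ∈ Ioo 0 T, Ioc 0 T ∈ 𝓝 x := fun x hx => Ioc_mem_nhds hx.1 hx.2
  have hud' : ∀ x ∈ Ioo 0 T, HasDerivAt u (1 - w x) x := fun x hx =>
    (hud x (Ioo_subset_Ioc_self hx)).hasDerivAt (hnhds x hx)
  have hderiv : EqOn (deriv u) (fun x => 1 - w x) (Ioo 0 T) := fun x hx => (hud' x hx).deriv
  have hvd : ∀ x ∈ Ioo 0 T, HasDerivAt v (w x) x := fun x hx =>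
    (hvw x (Ioo_subset_Ioc_self hx)).1.hasDerivAt (hnhds x hx)
  have hwd : ∀ x ∈ Ioo 0 T, HasDerivAt w (slopeField a b c x (v x) (w x)) x := fun x hx =>
    (hvw x (Ioo_subset_Ioc_self hx)).2.1.hasDerivAt (hnhds x hx)
  have hvc : ContinuousOn v (Ioo 0 T) := fun x hx => (hvd x hx).continuousAt.continuousWithinAt
  have hwc : ContinuousOn w (Ioo 0 T) := fun x hx => (hwd x hx).continuousAt.continuousWithinAt
  have hderiv2 : ∀ x ∈ Ioo 0 T, deriv (deriv u) x = -slopeField a b c x (v x) (w x) := by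
    intro x hx
    rw [(hderiv.eventuallyEq_of_mem (Ioo_mem_nhds hx.1 hx.2)).deriv_eq]
    exact ((hwd x hx).const_sub 1).deriv
  have hw1 : ContDiffOn ℝ 1 w (Ioo 0 T) := by
    rw [← zero_add (1 : WithTop ℕ∞), contDiffOn_succ_iff_deriv_of_isOpen isOpen_Ioo]
    refine ⟨fun x hx => (hwd x hx).differentiableAt.differentiableWithinAt, by simp, ?_⟩
    rw [contDiffOn_zero]
    have : ContinuousOn (fun x => slopeField a b c x (v x) (w x)) (Ioo 0 T) := by
      unfold slopeField
      exact ContinuousOn.div (by fun_prop) (by fun_prop) fun x hx => (pow_pos hx.1 2).ne'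
    exact this.congr fun x hx => (hwd x hx).deriv
  refine ⟨u, ⟨⟨?_, ?_, ?_, hu0⟩, hbd⟩, ?_⟩
  · intro x hx
    rcases hx.1.eq_or_lt with rfl | h
    · rw [ContinuousWithinAt, hu0]
      exact tendsto_of_tendsto_of_tendsto_of_le_of_le' tendsto_const_nhds
        (tendsto_id.mono_left nhdsWithin_le_nhds)
        (eventually_mem_nhdsWithin.mono fun x hx => (hbd x hx).1)
        (eventually_mem_nhdsWithin.mono fun x hx => (hbd x hx).2)
    · refine (hud x ⟨h, hx.2⟩).continuousWithinAt.mono_of_mem_nhdsWithin ?_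
      filter_upwards [self_mem_nhdsWithin, mem_nhdsWithin_of_mem_nhds (Ioi_mem_nhds h)]
        with y hy hy' using ⟨hy', hy.2⟩
  · rw [show (2 : WithTop ℕ∞) = 1 + 1 by norm_num,
      contDiffOn_succ_iff_deriv_of_isOpen isOpen_Ioo]
    exact ⟨fun x hx => (hud' x hx).differentiableAt.differentiableWithinAt, by simp,
      (contDiffOn_const.sub hw1).congr hderiv⟩
  · intro x hx
    have hx2 : x ^ 2 ≠ 0 := (pow_pos hx.1 2).ne'
    rw [hderiv2 x hx, hderiv hx, hupos hx.1, slopeField, mul_neg, mul_div_cancel₀ _ hx2]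
    ring
  · have := hud T ⟨hT, le_rfl⟩
    rwa [hwT, sub_sub_cancel] at this

/-! ### Cardinality and expansions -/

/-- Above: a continuous function is determined by its values on a countable dense set. Below: the
left derivative at `T` separates the solutions indexed by `q ∈ (0, 1)`. -/
theorem mk_boundedLocalSolutions {a b c T : ℝ} (hc : 0 < c) (hab : 0 < a + b) (hT : 0 < T) :
    Cardinal.mk ((Icc (0 : ℝ) T).domRestrict '' boundedLocalSolutions a b c T)
      = Cardinal.continuum := by
  apply le_antisymm
  · have hne : Nonempty (Icc (0 : ℝ) T) := ⟨⟨0, le_rfl, hT.le⟩⟩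
    let F : ((Icc (0 : ℝ) T).domRestrict '' boundedLocalSolutions a b c T) → ℕ → ℝ :=
      fun f n => f.1 (TopologicalSpace.denseSeq _ n)
    have hcont : ∀ f : ((Icc (0 : ℝ) T).domRestrict '' boundedLocalSolutions a b c T),
        Continuous f.1 := by
      rintro ⟨_, u, hu, rfl⟩
      exact hu.1.continuousOn.domRestrict
    have hF : Function.Injective F := by
      intro f g hfg
      refine Subtype.ext ((TopologicalSpace.denseRange_denseSeq _).equalizer (hcont f) (hcont g) ?_)
      exact hfg
    refine (Cardinal.mk_le_of_injective hF).trans ?_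
    simp [Cardinal.mk_real]
  · have hex : ∀ q : Ioo (0 : ℝ) 1, ∃ u ∈ boundedLocalSolutions a b c T,
        HasDerivWithinAt u q (Ioc 0 T) T := fun q =>
      exists_boundedLocalSolution_of_slope hc hab hT q.2
    choose u hu hud using hex
    let F : Ioo (0 : ℝ) 1 → ((Icc (0 : ℝ) T).domRestrict '' boundedLocalSolutions a b c T) :=
      fun q => ⟨_, mem_image_of_mem _ (hu q)⟩
    have hF : Function.Injective F := by
      intro p q hpq
      have hEq : EqOn (u p) (u q) (Icc 0 T) := domRestrict_eq_domRestrict_iff.1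
        (congrArg Subtype.val hpq)
      have hTm : T ∈ Ioc 0 T := ⟨hT, le_rfl⟩
      have h1 := (hud q).congr (fun x hx => hEq (Ioc_subset_Icc_self hx))
        (hEq (Ioc_subset_Icc_self hTm))
      exact Subtype.ext ((uniqueDiffOn_Ioc 0 T T hTm).eq_deriv _ (hud p) h1)
    rw [← Cardinal.mk_Ioo_real (zero_lt_one)]
    exact Cardinal.mk_le_of_injective hF

theorem isLittleO_of_mem_boundedLocalSolutions {a b c T : ℝ} {u : ℝ → ℝ} (hc : 0 < c)
    (hab : 0 < a + b) (hT : 0 < T) (hu : u ∈ boundedLocalSolutions a b c T) :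
    (fun x : ℝ => u x - (x - 2 / 3 * √((a + b) / c) * x ^ (3 / 2 : ℝ)))
        =o[𝓝[>] 0] (fun x : ℝ => x ^ (3 / 2 : ℝ)) ∧
    (fun x : ℝ => deriv u x - (1 - √((a + b) / c) * x ^ (1 / 2 : ℝ)))
        =o[𝓝[>] 0] (fun x : ℝ => x ^ (1 / 2 : ℝ)) := by
  obtain ⟨hsol, hbd⟩ := hu
  have h2 := hsol.contDiffOn
  rw [show (2 : WithTop ℕ∞) = 1 + 1 by norm_num,
    contDiffOn_succ_iff_deriv_of_isOpen isOpen_Ioo] at h2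
  have hv : ∀ x ∈ Ioo 0 T, HasDerivAt (fun x => x - u x) (1 - deriv u x) x := fun x hx =>
    (hasDerivAt_id x).sub ((h2.1 x hx).differentiableAt (Ioo_mem_nhds hx.1 hx.2)).hasDerivAt
  have hw : ∀ x ∈ Ioo 0 T, HasDerivAt (fun x => 1 - deriv u x)
      ((c * (1 - deriv u x) ^ 2 + a * x * (1 - deriv u x) + b * (x - u x) - (a + b) * x) / x ^ 2)
      x := by
    intro x hx
    have h3 := (((h2.2.2.differentiableOn one_ne_zero) x hx).differentiableAt
      (Ioo_mem_nhds hx.1 hx.2)).hasDerivAt.const_sub 1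
    refine h3.congr_deriv ?_
    have := hsol.equation x hx
    rw [eq_div_iff (pow_pos hx.1 2).ne']
    linarith
  have hvx : ∀ x ∈ Ioo 0 T, 0 ≤ x - u x ∧ x - u x ≤ x := fun x hx => by
    have := hbd x (Ioo_subset_Icc_self hx)
    constructor <;> linarith
  have hv0 : Tendsto (fun x => x - u x) (𝓝[>] 0) (𝓝 0) := by
    refine tendsto_of_tendsto_of_tendsto_of_le_of_le' tendsto_const_nhds
      (tendsto_id.mono_left nhdsWithin_le_nhds) ?_ ?_
    · filter_upwards [Ioo_mem_nhdsGT hT] with x hx using (hvx x hx).1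
    · filter_upwards [Ioo_mem_nhdsGT hT] with x hx using (hvx x hx).2
  have hlim := tendsto_slope_div_sqrt hc hab hT hv hw hv0 hvx
  obtain ⟨ho1, ho2⟩ := isLittleO_of_tendsto_slope_div_sqrt hT hv hv0 hlim
  have hsqrt : ∀ x : ℝ, √x = x ^ (1 / 2 : ℝ) := Real.sqrt_eq_rpow
  have h32 : ∀ x ∈ Ioi (0 : ℝ), x * √x = x ^ (3 / 2 : ℝ) := fun x hx => by
    rw [hsqrt, show (3 / 2 : ℝ) = 1 + 1 / 2 by norm_num, Real.rpow_add hx, Real.rpow_one]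
  refine ⟨ho1.neg_left.congr' ?_ ?_, ho2.neg_left.congr (fun x => ?_) hsqrt⟩
  · filter_upwards [self_mem_nhdsWithin] with x hx
    rw [h32 x hx]
    ring
  · filter_upwards [self_mem_nhdsWithin] with x hx using h32 x hx
  · rw [hsqrt x]
    ring

theorem corollary3p5 (a b c : ℝ) (hc : 0 < c) (hab : 0 < a + b) :
    (∀ x₀ : ℝ, 0 < x₀ →
      Cardinal.mk ((Icc (0 : ℝ) x₀).domRestrict '' boundedLocalSolutions a b c x₀)
        = Cardinal.continuum) ∧
    (∀ x₀ : ℝ, 0 < x₀ → ∀ u ∈ boundedLocalSolutions a b c x₀,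
      (fun x : ℝ => u x - (x - 2 / 3 * √((a + b) / c) * x ^ (3 / 2 : ℝ)))
          =o[𝓝[>] 0] (fun x : ℝ => x ^ (3 / 2 : ℝ)) ∧
      (fun x : ℝ => deriv u x - (1 - √((a + b) / c) * x ^ (1 / 2 : ℝ)))
          =o[𝓝[>] 0] (fun x : ℝ => x ^ (1 / 2 : ℝ))) :=
  ⟨fun _ h => mk_boundedLocalSolutions hc hab h,
    fun _ h _ hu => isLittleO_of_mem_boundedLocalSolutions hc hab h hu⟩
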